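/- Let $X$ be a non-singular (irreducible, projective) algebraic curve over $\mathbb C$, of any genus (in particular of genus $g\ge 2$). For integers $n\ge 1$, $d\in\mathbb Z$ and $k\ge 0$, let $\mathcal M(n,d)$ be the moduli space of stable vector bundles on $X$ of rank $n$ and degree $d$ (its points are the isomorphism classes of such bundles), let $\widetilde{\mathcal M}(n,d)$ be the moduli space of S-equivalence classes of semistable vector bundles on $X$ of rank $n$ and degree $d$, and define the Brill–Noether loci $$\mathcal W^{k-1}_{n,d}=\{E\in\mathcal M(n,d)\mid h^0(E)\ge k\},\qquad \widetilde{\mathcal W}^{k-1}_{n,d}=\{[E]\in\widetilde{\mathcal M}(n,d)\mid h^0(E)\ge k\},$$ where the second locus consists of the classes that contain a semistable bundle $E$ with $h^0(E)=\dim_{\mathbb C}H^0(X,E)\ge k$. If $\mathcal W^{k-1}_{n,d}\neq\emptyset$, then $\mathcal W^{k-1}_{n,d+nd'}\neq\emptyset$ for every integer $d'\ge 0$. If $\widetilde{\mathcal W}^{k-1}_{n,d}\neq\emptyset$, then $\widetilde{\mathcal W}^{k-1}_{n,d+nd'}\neq\emptyset$ for every integer $d'\ge 0$. -/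

import Mathlib

open CategoryTheory CategoryTheory.Limits AlgebraicGeometry TopologicalSpace

noncomputable section

/-- A non-singular (irreducible, complete) algebraic curve over `ℂ`: an integral scheme, proper over
`Spec ℂ`, that is regular of dimension one, i.e. whose local rings at the closed points are
discrete valuation rings. (Such a curve is automatically projective.) -/
structure NonsingularCurve where
  /-- the underlying scheme -/
  X : Scheme.{0}
  /-- the structure morphism -/
  str : X ⟶ Spec (CommRingCat.of ℂ)
  isIntegral : IsIntegral X
  isProper : IsProper str
  nonsingular : ∀ x : X, IsClosed ({x} : Set X) → IsDiscreteValuationRing (X.presheaf.stalk x)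

namespace NonsingularCurve

instance (C : NonsingularCurve) : IsIntegral C.X := C.isIntegral

instance (C : NonsingularCurve) : IsProper C.str := C.isProper

instance (C : NonsingularCurve) : IsLocallyNoetherian C.X :=
  haveI : IsLocallyNoetherian (Spec (CommRingCat.of ℂ)) := inferInstance
  LocallyOfFiniteType.isLocallyNoetherian C.str

variable (C : NonsingularCurve)

/-- Restriction of a section of a sheaf of modules to a smaller open set. -/
def res (E : C.X.Modules) {U V : C.X.Opens} (h : V ≤ U) (s : Γ(E, U)) : Γ(E, V) :=
  E.presheaf.map (homOfLE h).op s

/-- `e₁, …, eₙ ∈ Γ(U, E)` is a frame of `E` over `U`: the morphism `𝒪_U ^ n ⟶ E|_U` it defines is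
an isomorphism, i.e. bijective on sections over every open `V ⊆ U`. -/
def IsFrame (E : C.X.Modules) {n : ℕ} (U : C.X.Opens) (e : Fin n → Γ(E, U)) : Prop :=
  ∀ (V : C.X.Opens) (h : V ≤ U),
    Function.Bijective (fun c : Fin n → Γ(C.X, V) => ∑ i, c i • C.res E h (e i))

/-- `E` is a vector bundle of rank `n`: a sheaf of `𝒪_X`-modules that is locally free of rank `n`. -/
def IsVectorBundle (n : ℕ) (E : C.X.Modules) : Prop :=
  ∀ x : C.X, ∃ U : C.X.Opens, x ∈ U ∧ ∃ e : Fin n → Γ(E, U), C.IsFrame E U e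

/-- Let `e` be a frame of `E` over a nonempty open `U`. Then `e₁ ∧ … ∧ eₙ` is a rational section of
the line bundle `det E`. This says that this rational section has order `m` at the point `x`:
for a frame `f` of `E` near `x` with `eⱼ = ∑ᵢ Aᵢⱼ fᵢ`, one has
`e₁ ∧ … ∧ eₙ = det A · f₁ ∧ … ∧ fₙ`, and the rational function `det A` has order `m` at `x`. -/
def HasDetOrder (E : C.X.Modules) {n : ℕ} (U : C.X.Opens) (e : Fin n → Γ(E, U))
    (x : C.X) (m : ℤ) : Prop :=
  ∃ (V : C.X.Opens) (_ : x ∈ V) (f : Fin n → Γ(E, V)) (_ : C.IsFrame E V f)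
    (A : Matrix (Fin n) (Fin n) Γ(C.X, U ⊓ V)) (_ : Nonempty (U ⊓ V : C.X.Opens)),
    (∀ j, C.res E inf_le_left (e j) = ∑ i, A i j • C.res E inf_le_right (f i)) ∧
    C.X.ord (C.X.germToFunctionField (U ⊓ V) A.det) x = m

/-- The vector bundle `E` of rank `n` has degree `d`: `d` is the degree of the divisor `D` of a
nonzero rational section `e₁ ∧ … ∧ eₙ` of the line bundle `det E`, where `e` is a frame of `E` over
a nonempty open set. (The residue fields at the closed points are all `ℂ`, so that each of them
has degree one; the order at the generic point is zero by convention.) -/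
def HasDegree (n : ℕ) (E : C.X.Modules) (d : ℤ) : Prop :=
  ∃ (U : C.X.Opens) (_ : Nonempty U) (e : Fin n → Γ(E, U)) (_ : C.IsFrame E U e) (D : C.X → ℤ),
    (∀ x, C.HasDetOrder E U e x (D x)) ∧ D.support.Finite ∧ ∑ᶠ x, D x = d

/-- `E` is a stable vector bundle of rank `n` and degree `d`: every locally free subsheaf `F` (on a
non-singular curve these are all coherent subsheaves) with `0 < rk F < rk E` has slope
`deg F / rk F < deg E / rk E`. -/
structure IsStable (n : ℕ) (d : ℤ) (E : C.X.Modules) : Prop where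
  rank_pos : 0 < n
  isVectorBundle : C.IsVectorBundle n E
  hasDegree : C.HasDegree n E d
  slope_lt : ∀ (F : C.X.Modules) (i : F ⟶ E), Mono i → ∀ (r : ℕ) (e : ℤ), 0 < r → r < n →
    C.IsVectorBundle r F → C.HasDegree r F e → (e : ℚ) / r < (d : ℚ) / n

/-- `E` is a semistable vector bundle of rank `n` and degree `d`. -/
structure IsSemistable (n : ℕ) (d : ℤ) (E : C.X.Modules) : Prop where
  rank_pos : 0 < n
  isVectorBundle : C.IsVectorBundle n E
  hasDegree : C.HasDegree n E d
  slope_le : ∀ (F : C.X.Modules) (i : F ⟶ E), Mono i → ∀ (r : ℕ) (e : ℤ), 0 < r → r < n →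
    C.IsVectorBundle r F → C.HasDegree r F e → (e : ℚ) / r ≤ (d : ℚ) / n

/-- `C.HasGraded μ E G`: `E` has a Jordan–Hölder filtration `0 = E₀ ⊂ E₁ ⊂ … ⊂ Eₘ = E` whose
successive quotients are stable bundles of slope `μ`, and `G ≅ ⨁ Eᵢ / Eᵢ₋₁` is the associated
graded sheaf. -/
inductive HasGraded (μ : ℚ) : C.X.Modules → C.X.Modules → Prop
  | zero (E G : C.X.Modules) (hE : IsZero E) (hG : IsZero G) : HasGraded μ E G
  | step (S : ShortComplex C.X.Modules) (hS : S.ShortExact) (G G' : C.X.Modules)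
      (h : HasGraded μ S.X₁ G') (n : ℕ) (d : ℤ) (hst : C.IsStable n d S.X₃)
      (hμ : (d : ℚ) / n = μ) (hG : Nonempty (G ≅ G' ⊞ S.X₃)) : HasGraded μ S.X₂ G

/-- The set of points of the moduli space `𝓜(n, d)` of stable bundles of rank `n` and degree `d`:
isomorphism classes of such bundles. -/
def ModuliStable (n : ℕ) (d : ℤ) : Type 1 :=
  Quot fun E E' : {E : C.X.Modules // C.IsStable n d E} => Nonempty (E.1 ≅ E'.1)

/-- The set of points of the moduli space `𝓜̃(n, d)` of semistable bundles of rank `n` and degree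
`d`: classes of such bundles under S-equivalence, i.e. up to isomorphism of the graded sheaves of
Jordan–Hölder filtrations. -/
def ModuliSemistable (n : ℕ) (d : ℤ) : Type 1 :=
  Quot fun E E' : {E : C.X.Modules // C.IsSemistable n d E} =>
    ∃ G, C.HasGraded ((d : ℚ) / n) E.1 G ∧ C.HasGraded ((d : ℚ) / n) E'.1 G

/-- The ring homomorphism `ℂ → Γ(X, 𝒪_X)` given by the structure morphism. -/
def scalars : ℂ →+* Γ(C.X, ⊤) :=
  ((Scheme.ΓSpecIso (CommRingCat.of ℂ)).inv ≫ C.str.appTop).hom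

/-- `h⁰(E) = dim_ℂ H⁰(X, E)`. -/
def h0 (E : C.X.Modules) : Cardinal.{0} :=
  letI : Module ℂ Γ(E, (⊤ : C.X.Opens)) := Module.compHom _ C.scalars
  Module.rank ℂ Γ(E, (⊤ : C.X.Opens))

/-- The Brill–Noether locus `𝓦^{k-1}_{n,d} = {E ∈ 𝓜(n, d) | h⁰(E) ≥ k}`. -/
def brillNoether (n : ℕ) (d : ℤ) (k : ℕ) : Set (C.ModuliStable n d) :=
  {m | ∃ E : {E : C.X.Modules // C.IsStable n d E}, Quot.mk _ E = m ∧ (k : Cardinal) ≤ C.h0 E.1}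

/-- The semistable Brill–Noether locus `𝓦̃^{k-1}_{n,d}`: the classes in `𝓜̃(n, d)` of the semistable
bundles `E` with `h⁰(E) ≥ k`. -/
def brillNoetherSemistable (n : ℕ) (d : ℤ) (k : ℕ) : Set (C.ModuliSemistable n d) :=
  {m | ∃ E : {E : C.X.Modules // C.IsSemistable n d E},
    Quot.mk _ E = m ∧ (k : Cardinal) ≤ C.h0 E.1}

end NonsingularCurve

end

/-! Twist by a point. For a closed point `p`, the bundle `E(p) = E ⊗ 𝒪(p)` has degree `d + n`, so it
suffices to see that passing from `E` to `E(p)` preserves (semi)stability and does not lower `h⁰`;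
then iterate `d'` times.

Stability: twisting by `𝒪(-p)` undoes twisting by `𝒪(p)` (`untwist`), so a subsheaf `F ⊂ E(p)` gives
`F(-p) ⊂ E`. Both twists shift every slope by the same amount (`HasDivisor.hasDegree_twist`), so the
slope inequality for `F(-p)` is the one required of `F` (`HasDivisor.isStable_twist`,
`HasDivisor.isSemistable_twist`).

Sections: `𝒪(p)` has a nonzero section, and multiplication by it is injective because `E` is locally
free on an integral scheme (`h0_le_h0_twist`).

The line bundle is given by one transition function `g` on `W ∩ U`, with `W = X ∖ {p}` and `U` a
neighbourhood of `p` on which some `a` vanishes only at `p`, to order one (`exists_uniformizer`);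
`g` is the restriction of `a`. A section of the twist is a pair `(s, t)` on `V ∩ W` and `V ∩ U` with
`g s = t` on the overlap. The loci ask only for one representative with enough sections, so
S-equivalence plays no role beyond naming the class. -/

noncomputable section

/-! ### Restriction and gluing of sections -/

namespace NonsingularCurve

variable (C : NonsingularCurve)

/-- Restriction of regular functions to a smaller open set. -/
def fres {U V : C.X.Opens} (h : V ≤ U) : Γ(C.X, U) →+* Γ(C.X, V) :=
  (C.X.presheaf.map (homOfLE h).op).hom

variable {C}

@[simp]
lemma fres_fres {U V W : C.X.Opens} (h : V ≤ U) (h' : W ≤ V) (a : Γ(C.X, U)) :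
    C.fres h' (C.fres h a) = C.fres (h'.trans h) a := by
  simp only [fres, ← CommRingCat.comp_apply, ← Functor.map_comp]
  rfl

@[simp]
lemma fres_self {U : C.X.Opens} (h : U ≤ U) (a : Γ(C.X, U)) : C.fres h a = a := by
  simp [fres]

section Restriction

variable {E F : C.X.Modules} {U V W : C.X.Opens} (h : V ≤ U)

@[simp]
lemma res_add (s t : Γ(E, U)) : C.res E h (s + t) = C.res E h s + C.res E h t :=
  map_add _ _ _

@[simp]
lemma res_zero : C.res E h 0 = 0 :=
  map_zero _

@[simp]
lemma res_neg (s : Γ(E, U)) : C.res E h (-s) = -C.res E h s :=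
  map_neg _ _

@[simp]
lemma res_sum {ι : Type*} (I : Finset ι) (s : ι → Γ(E, U)) :
    C.res E h (∑ i ∈ I, s i) = ∑ i ∈ I, C.res E h (s i) :=
  map_sum (E.presheaf.map (homOfLE h).op).hom _ _

@[simp]
lemma res_smul (a : Γ(C.X, U)) (s : Γ(E, U)) :
    C.res E h (a • s) = C.fres h a • C.res E h s :=
  Scheme.Modules.map_smul _ _ _ _

@[simp]
lemma res_res (h' : W ≤ V) (s : Γ(E, U)) : C.res E h' (C.res E h s) = C.res E (h'.trans h) s := by
  simp only [res, ← ConcreteCategory.comp_apply, ← Functor.map_comp]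
  rfl

@[simp]
lemma res_self (h : U ≤ U) (s : Γ(E, U)) : C.res E h s = s := by
  simp [res]

lemma app_res (φ : E ⟶ F) (s : Γ(E, U)) : φ.app V (C.res E h s) = C.res F h (φ.app U s) :=
  CategoryTheory.congr_fun (φ.mapPresheaf.naturality (homOfLE h).op) s

lemma eq_of_res_eq {ι : Type} (O : ι → C.X.Opens) (hO : ∀ i, O i ≤ V) (hV : V ≤ iSup O)
    {s t : Γ(E, V)} (hst : ∀ i, C.res E (hO i) s = C.res E (hO i) t) : s = t :=
  TopCat.Sheaf.eq_of_locally_eq' ⟨E.presheaf, E.isSheaf⟩ O V (fun i ↦ homOfLE (hO i)) hV s t hst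

lemma exists_res_eq {ι : Type} (O : ι → C.X.Opens) (hO : ∀ i, O i ≤ V) (hV : V ≤ iSup O)
    (s : ∀ i, Γ(E, O i))
    (hs : ∀ i j, C.res E (inf_le_left : O i ⊓ O j ≤ O i) (s i) = C.res E inf_le_right (s j)) :
    ∃ t : Γ(E, V), ∀ i, C.res E (hO i) t = s i :=
  (TopCat.Sheaf.existsUnique_gluing' ⟨E.presheaf, E.isSheaf⟩ O V
    (fun i ↦ homOfLE (hO i)) hV s hs).exists

lemma eq_of_res_eq₂ {V₁ V₂ : C.X.Opens} (h₁ : V₁ ≤ V) (h₂ : V₂ ≤ V) (hV : V ≤ V₁ ⊔ V₂)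
    {s t : Γ(E, V)} (hs₁ : C.res E h₁ s = C.res E h₁ t) (hs₂ : C.res E h₂ s = C.res E h₂ t) :
    s = t :=
  TopCat.Sheaf.eq_of_locally_eq₂ ⟨E.presheaf, E.isSheaf⟩ (homOfLE h₁) (homOfLE h₂) hV s t hs₁ hs₂

lemma exists_res_eq₂ {V₁ V₂ : C.X.Opens} (h₁ : V₁ ≤ V) (h₂ : V₂ ≤ V) (hV : V ≤ V₁ ⊔ V₂)
    (s₁ : Γ(E, V₁)) (s₂ : Γ(E, V₂))
    (hs : C.res E (inf_le_left : V₁ ⊓ V₂ ≤ V₁) s₁ = C.res E inf_le_right s₂) :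
    ∃ t : Γ(E, V), C.res E h₁ t = s₁ ∧ C.res E h₂ t = s₂ := by
  obtain ⟨t, ht⟩ := exists_res_eq (E := E) (V := V) (fun b : Bool ↦ b.rec V₁ V₂)
    (by rintro (_ | _) <;> assumption)
    (hV.trans (sup_le (le_iSup (fun b : Bool ↦ (b.rec V₁ V₂ : C.X.Opens)) false)
      (le_iSup (fun b : Bool ↦ (b.rec V₁ V₂ : C.X.Opens)) true)))
    (fun b ↦ b.rec s₁ s₂) (by
      rintro (_ | _) (_ | _)
      · rfl
      · exact hs
      · have := congrArg (C.res E (le_inf inf_le_right inf_le_left : V₂ ⊓ V₁ ≤ V₁ ⊓ V₂)) hs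
        simpa using this.symm
      · rfl)
  exact ⟨t, ht false, ht true⟩

end Restriction

/-! ### Twisting by the line bundle of a cocycle -/

variable (C) in
/-- Two open sets covering the curve, with an invertible function on their intersection: the data
that define a line bundle with a trivialization over each of the two open sets. -/
structure Cocycle where
  /-- the first open set -/
  W : C.X.Opens
  /-- the second open set -/
  U : C.X.Opens
  cover : ∀ V : C.X.Opens, V ≤ V ⊓ W ⊔ V ⊓ U
  /-- the transition function -/
  g : Γ(C.X, W ⊓ U)ˣ

namespace Cocycle

variable (L : C.Cocycle)

/-- The cocycle of the dual line bundle. -/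
abbrev dual : C.Cocycle where
  W := L.W
  U := L.U
  cover := L.cover
  g := L.g⁻¹

/-- The sections over `V` of the tensor product of `E` with the line bundle of a cocycle. -/
def sections (E : C.X.Modules) (V : C.X.Opens) :
    AddSubgroup (Γ(E, V ⊓ L.W) × Γ(E, V ⊓ L.U)) where
  -- Asking for the relation on every `O` inside both open sets is equivalent to asking for it on
  -- their intersection, and avoids transport between different expressions for that intersection.
  carrier := {p | ∀ (O : C.X.Opens) (h₁ : O ≤ V ⊓ L.W) (h₂ : O ≤ V ⊓ L.U),
    C.fres (le_inf (h₁.trans inf_le_right) (h₂.trans inf_le_right)) L.g.1 • C.res E h₁ p.1 =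
      C.res E h₂ p.2}
  zero_mem' := by intro O h₁ h₂; simp
  add_mem' := by
    intro p q hp hq O h₁ h₂
    simp [smul_add, hp O h₁ h₂, hq O h₁ h₂]
  neg_mem' := by
    intro p hp O h₁ h₂
    simp [hp O h₁ h₂]

variable {L} in
lemma sections_ext {E : C.X.Modules} {V : C.X.Opens} {p q : L.sections E V}
    (h₁ : p.1.1 = q.1.1) (h₂ : p.1.2 = q.1.2) : p = q :=
  Subtype.ext (Prod.ext h₁ h₂)

instance (E : C.X.Modules) (V : C.X.Opens) : SMul Γ(C.X, V) (L.sections E V) where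
  smul a p := ⟨(C.fres (inf_le_left : V ⊓ L.W ≤ V) a • p.1.1, C.fres (inf_le_left : V ⊓ L.U ≤ V) a • p.1.2), by
    intro O h₁ h₂
    simp only [res_smul, fres_fres, ← p.2 O h₁ h₂]
    rw [smul_comm]⟩

lemma smul_fst {E : C.X.Modules} {V : C.X.Opens} (a : Γ(C.X, V)) (p : L.sections E V) :
    (a • p).1.1 = C.fres (inf_le_left : V ⊓ L.W ≤ V) a • p.1.1 := rfl

lemma smul_snd {E : C.X.Modules} {V : C.X.Opens} (a : Γ(C.X, V)) (p : L.sections E V) :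
    (a • p).1.2 = C.fres (inf_le_left : V ⊓ L.U ≤ V) a • p.1.2 := rfl

instance (E : C.X.Modules) (V : C.X.Opens) : Module Γ(C.X, V) (L.sections E V) where
  one_smul p := by apply sections_ext <;> simp [smul_fst, smul_snd]
  mul_smul a b p := by apply sections_ext <;> simp [smul_fst, smul_snd, mul_smul]
  smul_zero a := by apply sections_ext <;> simp [smul_fst, smul_snd]
  smul_add a p q := by apply sections_ext <;> simp [smul_fst, smul_snd]
  add_smul a b p := by apply sections_ext <;> simp [smul_fst, smul_snd, add_smul]
  zero_smul p := by apply sections_ext <;> simp [smul_fst, smul_snd]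

/-- The restriction maps of the twisted sheaf. -/
def sectionsRes (E : C.X.Modules) {U V : C.X.Opens} (h : V ≤ U) :
    L.sections E U →+ L.sections E V where
  toFun p := ⟨(C.res E (inf_le_inf_right _ h) p.1.1, C.res E (inf_le_inf_right _ h) p.1.2), by
    intro O h₁ h₂
    simpa using p.2 O (h₁.trans (inf_le_inf_right _ h)) (h₂.trans (inf_le_inf_right _ h))⟩
  map_zero' := by apply sections_ext <;> simp
  map_add' p q := by apply sections_ext <;> simp

lemma sectionsRes_smul (E : C.X.Modules) {U V : C.X.Opens} (h : V ≤ U) (a : Γ(C.X, U))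
    (p : L.sections E U) :
    L.sectionsRes E h (a • p) = C.fres h a • L.sectionsRes E h p := by
  apply sections_ext <;> simp [sectionsRes, smul_fst, smul_snd]

/-- The presheaf of abelian groups underlying the twisted sheaf. -/
def twistPresheaf (E : C.X.Modules) : TopCat.Presheaf Ab.{0} C.X where
  obj V := AddCommGrpCat.of (L.sections E V.unop)
  map i := AddCommGrpCat.ofHom (L.sectionsRes E i.unop.le)
  map_id V := by
    refine AddCommGrpCat.hom_ext (AddMonoidHom.ext fun p ↦ ?_)
    apply sections_ext <;> simp [sectionsRes]
  map_comp i j := by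
    refine AddCommGrpCat.hom_ext (AddMonoidHom.ext fun p ↦ ?_)
    apply sections_ext <;> simp [sectionsRes]

/-- The two components glue separately in `E`, and the relation `g s = t` between them is an
equality of sections of `E`, hence can be checked locally. -/
lemma twistPresheaf_isSheaf (E : C.X.Modules) : (L.twistPresheaf E).IsSheaf := by
  rw [TopCat.Presheaf.isSheaf_iff_isSheafUniqueGluing]
  intro ι O sf hsf
  have hc (i j : ι) : L.sectionsRes E (inf_le_left : O i ⊓ O j ≤ O i) (sf i) =
      L.sectionsRes E inf_le_right (sf j) := hsf i j
  have hfst (i j : ι) := congrArg (fun p ↦ p.1.1) (hc i j)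
  have hsnd (i j : ι) := congrArg (fun p ↦ p.1.2) (hc i j)
  obtain ⟨s, hs⟩ := exists_res_eq (E := E) (V := iSup O ⊓ L.W) (fun i ↦ O i ⊓ L.W)
    (fun i ↦ inf_le_inf_right _ (le_iSup O i)) (iSup_inf_eq O L.W).le (fun i ↦ (sf i).1.1)
    (fun i j ↦ by
      have := congrArg (C.res E (show (O i ⊓ L.W) ⊓ (O j ⊓ L.W) ≤ O i ⊓ O j ⊓ L.W from
        le_inf (inf_le_inf inf_le_left inf_le_left) (inf_le_left.trans inf_le_right))) (hfst i j)
      simpa [sectionsRes] using this)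
  obtain ⟨t, ht⟩ := exists_res_eq (E := E) (V := iSup O ⊓ L.U) (fun i ↦ O i ⊓ L.U)
    (fun i ↦ inf_le_inf_right _ (le_iSup O i)) (iSup_inf_eq O L.U).le (fun i ↦ (sf i).1.2)
    (fun i j ↦ by
      have := congrArg (C.res E (show (O i ⊓ L.U) ⊓ (O j ⊓ L.U) ≤ O i ⊓ O j ⊓ L.U from
        le_inf (inf_le_inf inf_le_left inf_le_left) (inf_le_left.trans inf_le_right))) (hsnd i j)
      simpa [sectionsRes] using this)
  have hst : (s, t) ∈ L.sections E (iSup O) := by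
    intro Q h₁ h₂
    refine eq_of_res_eq (fun i ↦ Q ⊓ O i) (fun i ↦ inf_le_left)
      (by rw [← inf_iSup_eq]; exact le_inf le_rfl (h₁.trans inf_le_left)) fun i ↦ ?_
    have := (sf i).2 (Q ⊓ O i) (le_inf inf_le_right (inf_le_left.trans (h₁.trans inf_le_right)))
      (le_inf inf_le_right (inf_le_left.trans (h₂.trans inf_le_right)))
    rw [← hs, ← ht] at this
    simpa using this
  refine ⟨⟨(s, t), hst⟩, fun i ↦ sections_ext (hs i) (ht i), fun p hp ↦ ?_⟩
  refine sections_ext ?_ ?_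
  · refine eq_of_res_eq (fun i ↦ O i ⊓ L.W) (fun i ↦ inf_le_inf_right _ (le_iSup O i))
      (iSup_inf_eq O L.W).le fun i ↦ ?_
    exact (congrArg (fun q : L.sections E (O i) ↦ q.1.1) (hp i)).trans (hs i).symm
  · refine eq_of_res_eq (fun i ↦ O i ⊓ L.U) (fun i ↦ inf_le_inf_right _ (le_iSup O i))
      (iSup_inf_eq O L.U).le fun i ↦ ?_
    exact (congrArg (fun q : L.sections E (O i) ↦ q.1.2) (hp i)).trans (ht i).symm

/-- The tensor product of a sheaf of modules with the line bundle of a cocycle. -/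
def twist (E : C.X.Modules) : C.X.Modules where
  val :=
    letI (V : C.X.Opensᵒᵖ) : Module (C.X.ringCatSheaf.obj.obj V) ((L.twistPresheaf E).obj V) :=
      inferInstanceAs (Module Γ(C.X, V.unop) (L.sections E V.unop))
    PresheafOfModules.ofPresheaf (L.twistPresheaf E)
      fun _ V' i a p ↦ L.sectionsRes_smul E (V := V'.unop) i.unop.le a p
  isSheaf := L.twistPresheaf_isSheaf E

/-- The sections of the twisted sheaf are the compatible pairs of sections. -/
def twistSections (E : C.X.Modules) (V : C.X.Opens) :
    Γ(L.twist E, V) ≃ₗ[Γ(C.X, V)] L.sections E V where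
  toFun p := p
  invFun p := p
  map_add' _ _ := rfl
  map_smul' _ _ := rfl
  left_inv _ := rfl
  right_inv _ := rfl

lemma twistSections_res {E : C.X.Modules} {U V : C.X.Opens} (h : V ≤ U) (p : Γ(L.twist E, U)) :
    L.twistSections E V (C.res (L.twist E) h p) = L.sectionsRes E h (L.twistSections E U p) :=
  rfl

end Cocycle

end NonsingularCurve

/-! ### Local triviality and functoriality of the twist -/

namespace NonsingularCurve

variable {C : NonsingularCurve}

lemma IsFrame.res {E : C.X.Modules} {n : ℕ} {U V : C.X.Opens} {e : Fin n → Γ(E, U)}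
    (he : C.IsFrame E U e) (h : V ≤ U) : C.IsFrame E V (fun i ↦ C.res E h (e i)) := by
  intro V' h'
  simpa using he V' (h'.trans h)

/-- An isomorphism of sheaves of modules over an open subset `O`. -/
structure LocalIso (E F : C.X.Modules) (O : C.X.Opens) where
  /-- the isomorphism on sections -/
  equiv (V : C.X.Opens) (h : V ≤ O) : Γ(E, V) ≃ₗ[Γ(C.X, V)] Γ(F, V)
  equiv_res (V V' : C.X.Opens) (h : V ≤ O) (h' : V' ≤ V) (s : Γ(E, V)) :
    equiv V' (h'.trans h) (C.res E h' s) = C.res F h' (equiv V h s)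

lemma LocalIso.isFrame {E F : C.X.Modules} {O : C.X.Opens} (φ : LocalIso E F O) {n : ℕ}
    {U : C.X.Opens} (h : U ≤ O) {e : Fin n → Γ(E, U)} (he : C.IsFrame E U e) :
    C.IsFrame F U (fun i ↦ φ.equiv U h (e i)) := by
  intro V hV
  convert! (φ.equiv V (hV.trans h)).bijective.comp (he V hV) using 2 with c
  simp [← φ.equiv_res]

namespace Cocycle

variable (L : C.Cocycle)

/-- Over the first open set, the sections of the twisted sheaf are those of the sheaf. -/
def sectionsEquivW (E : C.X.Modules) {V : C.X.Opens} (h : V ≤ L.W) :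
    Γ(E, V) ≃ₗ[Γ(C.X, V)] L.sections E V where
  toFun s := ⟨(C.res E inf_le_left s,
    C.fres (le_inf (inf_le_left.trans h) inf_le_right) L.g.1 • C.res E inf_le_left s), by
      intro O h₁ h₂
      simp⟩
  map_add' s t := by apply sections_ext <;> simp
  map_smul' a s := by
    apply sections_ext
    · simp [smul_fst]
    · simp only [res_smul, smul_snd, RingHom.id_apply]
      exact smul_comm _ _ _
  invFun p := C.res E (le_inf le_rfl h) p.1.1
  left_inv s := by simp
  right_inv p := by
    apply sections_ext
    · simp
    · have := p.2 (V ⊓ L.U) (le_inf inf_le_left (inf_le_left.trans h)) le_rfl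
      simpa using this

/-- Over the second open set, the sections of the twisted sheaf are those of the sheaf. -/
def sectionsEquivU (E : C.X.Modules) {V : C.X.Opens} (h : V ≤ L.U) :
    Γ(E, V) ≃ₗ[Γ(C.X, V)] L.sections E V where
  toFun s := ⟨(C.fres (le_inf inf_le_right (inf_le_left.trans h)) L.g⁻¹.1 •
    C.res E inf_le_left s, C.res E inf_le_left s), by
      intro O h₁ h₂
      simp [smul_smul, ← map_mul]⟩
  map_add' s t := by apply sections_ext <;> simp
  map_smul' a s := by
    apply sections_ext
    · simp only [res_smul, smul_fst, RingHom.id_apply]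
      exact smul_comm _ _ _
    · simp [smul_snd]
  invFun p := C.res E (le_inf le_rfl h) p.1.2
  left_inv s := by simp
  right_inv p := by
    apply sections_ext
    · have := p.2 (V ⊓ L.W) le_rfl (le_inf inf_le_left (inf_le_left.trans h))
      simp only [res_self] at this
      simp [← this, smul_smul, ← map_mul]
    · simp

/-- The line bundle of a cocycle is trivial over the first open set. -/
def isoW (E : C.X.Modules) : LocalIso E (L.twist E) L.W where
  equiv V h := (L.sectionsEquivW E h).trans (L.twistSections E V).symm
  equiv_res V V' h h' s := by
    apply (L.twistSections E V').injective
    rw [twistSections_res]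
    apply sections_ext <;> simp [sectionsEquivW, sectionsRes]

/-- The line bundle of a cocycle is trivial over the second open set. -/
def isoU (E : C.X.Modules) : LocalIso E (L.twist E) L.U where
  equiv V h := (L.sectionsEquivU E h).trans (L.twistSections E V).symm
  equiv_res V V' h h' s := by
    apply (L.twistSections E V').injective
    rw [twistSections_res]
    apply sections_ext <;> simp [sectionsEquivU, sectionsRes]

/-- The two trivializations send `s` to `(s, g s)` and `(g⁻¹ s, s)`. The factor `g` between them is
what changes the degree. -/
lemma isoW_eq_smul_isoU {E : C.X.Modules} {V : C.X.Opens} (h₁ : V ≤ L.W) (h₂ : V ≤ L.U) (s : Γ(E, V)) :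
    (L.isoW E).equiv V h₁ s = C.fres (le_inf h₁ h₂) L.g.1 • (L.isoU E).equiv V h₂ s := by
  rw [← map_smul]
  apply (L.twistSections E V).injective
  apply sections_ext <;> 
    simp [isoW, isoU, sectionsEquivW, sectionsEquivU, smul_fst, smul_snd, smul_smul, ← map_mul]

lemma mem_or (x : C.X) : x ∈ L.W ∨ x ∈ L.U := by
  have := L.cover ⊤ (x := x) trivial
  simpa using this

lemma isVectorBundle_twist {n : ℕ} {E : C.X.Modules} (hE : C.IsVectorBundle n E) :
    C.IsVectorBundle n (L.twist E) := by
  intro x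
  obtain ⟨V, hx, e, he⟩ := hE x
  rcases L.mem_or x with h | h
  · exact ⟨V ⊓ L.W, ⟨hx, h⟩, _, (L.isoW E).isFrame inf_le_right (he.res inf_le_left)⟩
  · exact ⟨V ⊓ L.U, ⟨hx, h⟩, _, (L.isoU E).isFrame inf_le_right (he.res inf_le_left)⟩

/-- The action of a morphism of sheaves of modules on the sections of the twisted sheaves. -/
def sectionsMap {E F : C.X.Modules} (φ : E ⟶ F) (V : C.X.Opens) :
    L.sections E V →ₗ[Γ(C.X, V)] L.sections F V where
  toFun p := ⟨(φ.app _ p.1.1, φ.app _ p.1.2), by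
    intro O h₁ h₂
    have := congrArg (φ.app O) (p.2 O h₁ h₂)
    simpa [app_res] using this⟩
  map_add' p q := by apply sections_ext <;> simp
  map_smul' a p := by apply sections_ext <;> simp [smul_fst, smul_snd]

/-- A morphism of sheaves of modules given by compatible linear maps between the sections. -/
def homMk {E F : C.X.Modules} (φ : ∀ V : C.X.Opens, Γ(E, V) →ₗ[Γ(C.X, V)] Γ(F, V))
    (hφ : ∀ (U V : C.X.Opens) (h : V ≤ U) (s : Γ(E, U)),
      φ V (C.res E h s) = C.res F h (φ U s)) : E ⟶ F where
  val := PresheafOfModules.homMk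
    { app V := AddCommGrpCat.ofHom (φ V.unop).toAddMonoidHom
      naturality U V i := AddCommGrpCat.hom_ext (AddMonoidHom.ext fun s ↦
        hφ U.unop V.unop i.unop.le s) }
    fun V a s ↦ (φ V.unop).map_smul a s

/-- Twisting is functorial. -/
def twistMap {E F : C.X.Modules} (φ : E ⟶ F) : L.twist E ⟶ L.twist F :=
  homMk (fun V ↦ (L.twistSections F V).symm.toLinearMap ∘ₗ L.sectionsMap φ V ∘ₗ
    (L.twistSections E V).toLinearMap) fun _ _ _ _ ↦
      sections_ext (L := L) (app_res _ _ _) (app_res _ _ _)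

lemma app_injective {E F : C.X.Modules} (φ : E ⟶ F) [Mono φ] (V : C.X.Opens) :
    Function.Injective (φ.app V) := by
  have : Mono ((Scheme.Modules.toPresheaf C.X).map φ) := inferInstance
  have := (NatTrans.mono_iff_mono_app _).mp this (.op V)
  exact (AddCommGrpCat.mono_iff_injective _).mp this

lemma mono_of_app_injective {E F : C.X.Modules} (φ : E ⟶ F)
    (h : ∀ V, Function.Injective (φ.app V)) : Mono φ := by
  apply (Scheme.Modules.toPresheaf C.X).mono_of_mono_map
  rw [NatTrans.mono_iff_mono_app]
  exact fun V ↦ (AddCommGrpCat.mono_iff_injective _).mpr (h V.unop)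

instance {E F : C.X.Modules} (φ : E ⟶ F) [Mono φ] : Mono (L.twistMap φ) := by
  refine mono_of_app_injective _ fun V p q h ↦ ?_
  have h' : L.sectionsMap φ V (L.twistSections E V p) = L.sectionsMap φ V (L.twistSections E V q) := h
  refine (L.twistSections E V).injective (sections_ext ?_ ?_)
  · exact app_injective φ _ (congrArg (fun r ↦ r.1.1) h')
  · exact app_injective φ _ (congrArg (fun r ↦ r.1.2) h')

end Cocycle

end NonsingularCurve

/-! ### Degree and stability of the twist -/

namespace NonsingularCurve

variable {C : NonsingularCurve}

lemma genericPoint_mem (U : C.X.Opens) [h : Nonempty U] : genericPoint C.X ∈ U :=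
  ((genericPoint_spec C.X).mem_open_set_iff U.isOpen).mpr (by simpa using h)

lemma nonempty_inf (U V : C.X.Opens) [Nonempty U] [Nonempty V] : Nonempty (U ⊓ V : C.X.Opens) :=
  ⟨⟨genericPoint C.X, genericPoint_mem U, genericPoint_mem V⟩⟩

lemma germToFunctionField_fres {U V : C.X.Opens} [Nonempty U] [Nonempty V] (h : V ≤ U)
    (a : Γ(C.X, U)) :
    C.X.germToFunctionField V (C.fres h a) = C.X.germToFunctionField U a :=
  C.X.presheaf.germ_res_apply (homOfLE h) _ _ a

/-- Expanding `f` in `e` gives a matrix `B`, and uniqueness of coordinates in `f` gives `A Bᵀ = 1`.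
Hence `det A` is nonzero in the function field, as additivity of orders requires. -/
lemma IsFrame.isUnit_det {E : C.X.Modules} {n : ℕ} {U : C.X.Opens} {e f : Fin n → Γ(E, U)}
    (he : C.IsFrame E U e) (hf : C.IsFrame E U f) {A : Matrix (Fin n) (Fin n) Γ(C.X, U)}
    (hA : ∀ j, e j = ∑ i, A i j • f i) : IsUnit A.det := by
  choose B hB using fun j ↦ (he U le_rfl).2 (f j)
  simp only [res_self] at hB
  have hAB : A * (Matrix.of B).transpose = 1 := by
    refine Matrix.ext fun i j ↦ congrFun ((hf U le_rfl).1 (a₁ := fun i ↦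
      (A * (Matrix.of B).transpose) i j) (a₂ := fun i ↦ (1 : Matrix _ _ _) i j) ?_) i
    simp only [res_self, Matrix.mul_apply, Matrix.one_apply, ite_smul, one_smul, zero_smul,
      Finset.sum_ite_eq', Finset.mem_univ, if_true, Finset.sum_smul]
    rw [Finset.sum_comm]
    conv_rhs => rw [← hB j]
    refine Finset.sum_congr rfl fun k _ ↦ ?_
    rw [hA k, Finset.smul_sum]
    refine Finset.sum_congr rfl fun i _ ↦ ?_
    simp [smul_smul, mul_comm]
  exact (Matrix.isUnit_iff_isUnit_det A).mp (IsUnit.of_mul_eq_one _ hAB)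

namespace Cocycle

variable (L : C.Cocycle)

/-- The sections of a sheaf of modules as sections of the twist of a twist. -/
def sectionsUntwist (E : C.X.Modules) (V : C.X.Opens) :
    Γ(E, V) →ₗ[Γ(C.X, V)] L.dual.sections (L.twist E) V where
  toFun s := ⟨((L.isoW E).equiv (V ⊓ L.W) inf_le_right (C.res E inf_le_left s),
    (L.isoU E).equiv (V ⊓ L.U) inf_le_right (C.res E inf_le_left s)), by
      intro O h₁ h₂
      rw [← (L.isoW E).equiv_res, ← (L.isoU E).equiv_res, L.isoW_eq_smul_isoU _
        (h₂.trans inf_le_right), smul_smul]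
      simp [← map_mul]⟩
  map_add' s t := by apply sections_ext <;> simp
  map_smul' a s := by
    apply sections_ext
    · simp only [res_smul, map_smul]
      rfl
    · simp only [res_smul, map_smul]
      rfl

lemma sectionsUntwist_res (E : C.X.Modules) {U V : C.X.Opens} (h : V ≤ U) (s : Γ(E, U)) :
    L.sectionsUntwist E V (C.res E h s) = L.dual.sectionsRes _ h (L.sectionsUntwist E U s) := by
  apply sections_ext
  · simp [sectionsUntwist, sectionsRes, ← (L.isoW E).equiv_res]
  · simp [sectionsUntwist, sectionsRes, ← (L.isoU E).equiv_res]

/-- A sheaf of modules is recovered from its twist by a line bundle. -/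
def untwist (E : C.X.Modules) : E ⟶ L.dual.twist (L.twist E) :=
  homMk (fun V ↦ (L.dual.twistSections _ V).symm.toLinearMap ∘ₗ L.sectionsUntwist E V)
    fun _ _ h s ↦ L.sectionsUntwist_res E h s

/-- In the double twist the transition functions `g` and `g⁻¹` cancel, so a compatible pair is a
pair of sections of `E` that agree on the overlap, and these glue uniquely. -/
lemma bijective_untwist_app (E : C.X.Modules) (V : C.X.Opens) :
    Function.Bijective ((L.untwist E).app V) := by
  constructor
  · intro s t h
    have h' := congrArg (L.dual.twistSections _ V) h
    refine eq_of_res_eq₂ inf_le_left inf_le_left (L.cover V) ?_ ?_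
    · exact ((L.isoW E).equiv _ inf_le_right).injective (congrArg (fun p ↦ p.1.1) h')
    · exact ((L.isoU E).equiv _ inf_le_right).injective (congrArg (fun p ↦ p.1.2) h')
  · intro p
    obtain ⟨q, rfl⟩ := (L.dual.twistSections _ V).symm.surjective p
    obtain ⟨s, hs⟩ := ((L.isoW E).equiv (V ⊓ L.W) inf_le_right).surjective q.1.1
    obtain ⟨t, ht⟩ := ((L.isoU E).equiv (V ⊓ L.U) inf_le_right).surjective q.1.2
    have hst : C.res E (inf_le_left : (V ⊓ L.W) ⊓ (V ⊓ L.U) ≤ _) s = C.res E inf_le_right t := by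
      have := q.2 ((V ⊓ L.W) ⊓ (V ⊓ L.U)) inf_le_left inf_le_right
      rw [← hs, ← ht] at this
      rw [← (L.isoW E).equiv_res, ← (L.isoU E).equiv_res, L.isoW_eq_smul_isoU _
        (inf_le_right.trans inf_le_right), smul_smul] at this
      simpa [← map_mul] using this
    obtain ⟨r, hr₁, hr₂⟩ := exists_res_eq₂ inf_le_left inf_le_left (L.cover V) s t hst
    refine ⟨r, congrArg (L.dual.twistSections _ V).symm (sections_ext ?_ ?_)⟩
    · rw [← hs, ← hr₁]; rfl
    · rw [← ht, ← hr₂]; rfl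

instance (E : C.X.Modules) : IsIso (L.untwist E) := by
  rw [Scheme.Modules.Hom.isIso_iff_isIso_app]
  intro V
  exact (ConcreteCategory.isIso_iff_bijective _).mpr (L.bijective_untwist_app E V)

/-- The line bundle of the cocycle `L` is `𝒪(m p)`: the transition function is invertible away
from the point `p`, where it has order `m`. -/
structure HasDivisor (p : C.X) (m : ℤ) : Prop where
  mem_W : ∀ x, x ∈ L.W ↔ x ≠ p
  mem_U : p ∈ L.U
  nonempty_W : Nonempty L.W
  ord_eq : ∀ _ : Nonempty (L.W ⊓ L.U : C.X.Opens),
    C.X.ord (C.X.germToFunctionField (L.W ⊓ L.U) L.g.1) p = m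

variable {L} {p : C.X} {m : ℤ}

lemma HasDivisor.nonempty_U (hL : L.HasDivisor p m) : Nonempty L.U := ⟨⟨p, hL.mem_U⟩⟩

lemma germToFunctionField_unit_ne_zero {U : C.X.Opens} [Nonempty U] (a : Γ(C.X, U)ˣ) :
    C.X.germToFunctionField U a.1 ≠ 0 :=
  (a.isUnit.map (C.X.germToFunctionField U).hom).ne_zero

lemma ord_one_eq_zero (p : C.X) {U : C.X.Opens} [Nonempty U] :
    C.X.ord (C.X.germToFunctionField U 1) p = 0 := by
  have : Nonempty (⊤ : C.X.Opens) := ⟨⟨p, trivial⟩⟩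
  have := Scheme.ord_of_isUnit (X := C.X) (U := ⊤) isUnit_one (x := p) trivial
  simpa using this

lemma HasDivisor.dual (hL : L.HasDivisor p m) : L.dual.HasDivisor p (-m) where
  mem_W := hL.mem_W
  mem_U := hL.mem_U
  nonempty_W := hL.nonempty_W
  ord_eq h := by
    have h' : Nonempty (L.W ⊓ L.U : C.X.Opens) := h
    have := Scheme.ord_mul (x := p) (germToFunctionField_unit_ne_zero L.g)
      (germToFunctionField_unit_ne_zero L.g⁻¹)
    rw [hL.ord_eq h', ← map_mul, Units.mul_inv,
      ord_one_eq_zero] at this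
    change C.X.ord (C.X.germToFunctionField (L.W ⊓ L.U) L.g⁻¹.1) p = -m
    omega

/-- Such an `x` lies in `W`, where both frames are carried over by the same trivialization; the
change of frame matrix is unchanged up to restriction. -/
lemma HasDivisor.hasDetOrder_twist_of_ne (hL : L.HasDivisor p m) {E : C.X.Modules} {n : ℕ}
    {U : C.X.Opens} {e : Fin n → Γ(E, U)} {x : C.X} {k : ℤ} (h : C.HasDetOrder E U e x k)
    (hx : x ≠ p) :
    C.HasDetOrder (L.twist E) (U ⊓ L.W)
      (fun i ↦ (L.isoW E).equiv _ inf_le_right (C.res E inf_le_left (e i))) x k := by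
  have := hL.nonempty_W
  obtain ⟨V, hxV, f, hf, A, hUV, hA, hk⟩ := h
  have hle : (U ⊓ L.W) ⊓ (V ⊓ L.W) ≤ U ⊓ V := inf_le_inf inf_le_left inf_le_left
  have hne : Nonempty ((U ⊓ L.W) ⊓ (V ⊓ L.W) : C.X.Opens) := by
    have := genericPoint_mem (U ⊓ V)
    have := genericPoint_mem L.W
    exact ⟨⟨genericPoint C.X, by simp_all⟩⟩
  refine ⟨V ⊓ L.W, ⟨hxV, (hL.mem_W x).mpr hx⟩, _,
    (L.isoW E).isFrame inf_le_right (hf.res inf_le_left), A.map (C.fres hle), hne, fun j ↦ ?_, ?_⟩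
  · have := congrArg (C.res E hle) (hA j)
    simp only [res_res, res_sum, res_smul] at this
    simp only [← (L.isoW E).equiv_res, res_res, this, map_sum, map_smul, Matrix.map_apply]
  · rw [← RingHom.mapMatrix_apply, ← RingHom.map_det, germToFunctionField_fres, hk]

/-- The rational frame is carried over by the trivialization on `W`, but a frame near `p` must use
the one on `U`. The matrix `A` becomes `g A`, with determinant `gⁿ det A`. -/
lemma HasDivisor.hasDetOrder_twist (hL : L.HasDivisor p m) {E : C.X.Modules} {n : ℕ}
    {U : C.X.Opens} {e : Fin n → Γ(E, U)} {k : ℤ} (he : C.IsFrame E U e)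
    (h : C.HasDetOrder E U e p k) :
    C.HasDetOrder (L.twist E) (U ⊓ L.W)
      (fun i ↦ (L.isoW E).equiv _ inf_le_right (C.res E inf_le_left (e i))) p (k + n * m) := by
  have := hL.nonempty_W
  have := hL.nonempty_U
  obtain ⟨V, hxV, f, hf, A, hUV, hA, hk⟩ := h
  have hle : (U ⊓ L.W) ⊓ (V ⊓ L.U) ≤ U ⊓ V := inf_le_inf inf_le_left inf_le_left
  have hle' : (U ⊓ L.W) ⊓ (V ⊓ L.U) ≤ L.W ⊓ L.U := inf_le_inf inf_le_right inf_le_right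
  have hWU := nonempty_inf L.W L.U
  have hne : Nonempty ((U ⊓ L.W) ⊓ (V ⊓ L.U) : C.X.Opens) := by
    have := genericPoint_mem (U ⊓ V)
    have := genericPoint_mem (L.W ⊓ L.U)
    exact ⟨⟨genericPoint C.X, by simp_all⟩⟩
  have hdet : C.X.germToFunctionField (U ⊓ V) A.det ≠ 0 :=
    (((he.res inf_le_left).isUnit_det (hf.res inf_le_right) hA).map
      (C.X.germToFunctionField (U ⊓ V)).hom).ne_zero
  have hg := germToFunctionField_unit_ne_zero L.g
  refine ⟨V ⊓ L.U, ⟨hxV, hL.mem_U⟩, _,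
    (L.isoU E).isFrame inf_le_right (hf.res inf_le_left),
    C.fres hle' L.g.1 • A.map (C.fres hle), hne, fun j ↦ ?_, ?_⟩
  · have := congrArg (C.res E hle) (hA j)
    simp only [res_res, res_sum, res_smul] at this
    simp only [← (L.isoW E).equiv_res, ← (L.isoU E).equiv_res, res_res, this, map_sum, map_smul,
      Matrix.map_apply, Matrix.smul_apply, smul_eq_mul]
    refine Finset.sum_congr rfl fun i _ ↦ ?_
    rw [L.isoW_eq_smul_isoU _ (inf_le_right.trans inf_le_right), smul_smul, mul_comm]
  · have hpow (n : ℕ) : C.X.ord (C.X.germToFunctionField (L.W ⊓ L.U) L.g.1 ^ n) p = n * m := by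
      induction n with
      | zero =>
        simpa using ord_one_eq_zero p (U := L.W)
      | succ n ih =>
        rw [pow_succ, Scheme.ord_mul (pow_ne_zero _ hg) hg, ih, hL.ord_eq hWU]
        push_cast
        ring
    rw [Matrix.det_smul, ← RingHom.mapMatrix_apply, ← RingHom.map_det, Fintype.card_fin, map_mul,
      map_pow, germToFunctionField_fres, germToFunctionField_fres,
      Scheme.ord_mul (pow_ne_zero _ hg) hdet, hk, hpow, add_comm]

/-- The divisor of the rational section of the determinant changes only at `p`, by `n m`. -/
lemma HasDivisor.hasDegree_twist (hL : L.HasDivisor p m) {E : C.X.Modules} {n : ℕ} {d : ℤ}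
    (hE : C.HasDegree n E d) : C.HasDegree n (L.twist E) (d + n * m) := by
  classical
  have := hL.nonempty_W
  obtain ⟨U, hU, e, he, D, hD, hfin, hsum⟩ := hE
  have hfin' : (Function.support fun x ↦ if x = p then (n : ℤ) * m else 0).Finite :=
    (Set.finite_singleton p).subset fun x hx ↦ by
      by_contra h
      simp_all
  refine ⟨U ⊓ L.W, nonempty_inf U L.W, _, (L.isoW E).isFrame inf_le_right (he.res inf_le_left),
    fun x ↦ D x + if x = p then (n : ℤ) * m else 0, fun x ↦ ?_, ?_, ?_⟩
  · by_cases hx : x = p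
    · subst hx
      simpa using hL.hasDetOrder_twist he (hD x)
    · simpa [hx] using hL.hasDetOrder_twist_of_ne (hD x) hx
  · exact (hfin.union hfin').subset (Function.support_add _ _)
  · rw [finsum_add_distrib hfin hfin', hsum, finsum_eq_single _ p (by simp_all)]
    simp

lemma slope_add_mul (n : ℕ) (d : ℤ) (hn : 0 < n) :
    ((d + n * m : ℤ) : ℚ) / n = d / n + m := by
  have : (n : ℚ) ≠ 0 := by positivity
  push_cast
  field_simp

/-- A subsheaf `F` of the twist, twisted back, embeds in the double twist of `E`, which is `E`
itself. Its slope and that of the ambient bundle both drop by `m`. -/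
lemma HasDivisor.isStable_twist (hL : L.HasDivisor p m) {E : C.X.Modules} {n : ℕ} {d : ℤ}
    (hE : C.IsStable n d E) : C.IsStable n (d + n * m) (L.twist E) where
  rank_pos := hE.rank_pos
  isVectorBundle := L.isVectorBundle_twist hE.isVectorBundle
  hasDegree := hL.hasDegree_twist hE.hasDegree
  slope_lt F i _ r e hr hrn hF he := by
    have := hE.slope_lt (L.dual.twist F) (L.dual.twistMap i ≫ inv (L.untwist E)) inferInstance r
      (e + r * -m) hr hrn (L.dual.isVectorBundle_twist hF) (hL.dual.hasDegree_twist he)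
    rw [slope_add_mul r e hr] at this
    rw [slope_add_mul n d hE.rank_pos]
    push_cast at this
    linarith

lemma HasDivisor.isSemistable_twist (hL : L.HasDivisor p m) {E : C.X.Modules} {n : ℕ} {d : ℤ}
    (hE : C.IsSemistable n d E) : C.IsSemistable n (d + n * m) (L.twist E) where
  rank_pos := hE.rank_pos
  isVectorBundle := L.isVectorBundle_twist hE.isVectorBundle
  hasDegree := hL.hasDegree_twist hE.hasDegree
  slope_le F i _ r e hr hrn hF he := by
    have := hE.slope_le (L.dual.twist F) (L.dual.twistMap i ≫ inv (L.untwist E)) inferInstance r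
      (e + r * -m) hr hrn (L.dual.isVectorBundle_twist hF) (hL.dual.hasDegree_twist he)
    rw [slope_add_mul r e hr] at this
    rw [slope_add_mul n d hE.rank_pos]
    push_cast at this
    linarith

end Cocycle

end NonsingularCurve

/-! ### Multiplication by the canonical section -/

namespace NonsingularCurve

variable {C : NonsingularCurve}

/-- Identity principle: in a local frame the coordinates are regular functions on an integral
scheme, where restriction to a nonempty open set is injective; irreducibility makes `V` meet every
chart. -/
lemma eq_zero_of_res_eq_zero {n : ℕ} {E : C.X.Modules} (hE : C.IsVectorBundle n E)
    {U V : C.X.Opens} [Nonempty V] (h : V ≤ U) {s : Γ(E, U)} (hs : C.res E h s = 0) : s = 0 := by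
  choose O hO e he using hE
  refine eq_of_res_eq (fun x : U ↦ U ⊓ O x) (fun x ↦ inf_le_left)
    (fun x hx ↦ Opens.mem_iSup.mpr ⟨⟨x, hx⟩, hx, hO x⟩) fun x ↦ ?_
  obtain ⟨c, hc⟩ := (he x (U ⊓ O x) inf_le_right).2 (C.res E inf_le_left s)
  have hne : Nonempty (O x) := ⟨⟨x, hO x⟩⟩
  have hne' := nonempty_inf V (O x)
  have hle : V ⊓ O x ≤ U ⊓ O x := inf_le_inf_right _ h
  have hc0 : (fun i ↦ C.fres hle (c i)) = 0 := by
    refine (he x (V ⊓ O x) inf_le_right).1 ?_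
    have h₁ := congrArg (C.res E hle) hc
    have h₂ := congrArg (C.res E (inf_le_left : V ⊓ O x ≤ V)) hs
    simp only [res_sum, res_smul, res_res, res_zero] at h₁ h₂
    simp [h₁, h₂]
  have hc' : c = 0 := by
    funext i
    exact map_injective_of_isIntegral C.X (homOfLE hle) ((congrFun hc0 i).trans (map_zero _).symm)
  rw [← hc, hc']
  simp

namespace Cocycle

variable {L : C.Cocycle}

/-- If the transition function is the restriction of a regular function `a`, the line bundle has
a canonical section, by which one can multiply. -/
def mulSection (a : Γ(C.X, L.U)) (ha : C.fres inf_le_right a = L.g.1) (E : C.X.Modules)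
    (V : C.X.Opens) : Γ(E, V) →ₗ[Γ(C.X, V)] L.sections E V where
  toFun s := ⟨(C.res E inf_le_left s, C.fres (inf_le_right : V ⊓ L.U ≤ L.U) a • C.res E inf_le_left s), by
    intro O h₁ h₂
    simp [← ha]⟩
  map_add' s t := by apply sections_ext <;> simp
  map_smul' b s := by
    apply sections_ext
    · simp [smul_fst]
    · simp only [res_smul, smul_snd, RingHom.id_apply]
      exact smul_comm _ _ _

/-- The canonical section is `1` on `W`, so the first component of the product is just the
restriction of `s` to `V ∩ W`. -/
lemma mulSection_injective [Nonempty L.W] (a : Γ(C.X, L.U)) (ha : C.fres inf_le_right a = L.g.1)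
    {n : ℕ} {E : C.X.Modules} (hE : C.IsVectorBundle n E) (V : C.X.Opens) [Nonempty V] :
    Function.Injective (mulSection a ha E V) := by
  rw [injective_iff_map_eq_zero]
  intro s hs
  have := nonempty_inf V L.W
  exact eq_zero_of_res_eq_zero hE inf_le_left (congrArg (fun p ↦ p.1.1) hs)

lemma h0_le_h0_twist [Nonempty L.W] (a : Γ(C.X, L.U)) (ha : C.fres inf_le_right a = L.g.1)
    {n : ℕ} {E : C.X.Modules} (hE : C.IsVectorBundle n E) : C.h0 E ≤ C.h0 (L.twist E) := by
  have : Nonempty (⊤ : C.X.Opens) := ⟨⟨genericPoint C.X, trivial⟩⟩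
  let φ := (L.twistSections E ⊤).symm.toLinearMap ∘ₗ mulSection a ha E ⊤
  have hφ : Function.Injective φ :=
    (L.twistSections E ⊤).symm.injective.comp (mulSection_injective a ha hE ⊤)
  let : Module ℂ Γ(E, (⊤ : C.X.Opens)) := Module.compHom _ C.scalars
  let : Module ℂ Γ(L.twist E, (⊤ : C.X.Opens)) := Module.compHom _ C.scalars
  exact LinearMap.rank_le_of_injective
    ({ toFun := φ, map_add' := φ.map_add, map_smul' := fun c ↦ φ.map_smul (C.scalars c) } :
      Γ(E, (⊤ : C.X.Opens)) →ₗ[ℂ] Γ(L.twist E, (⊤ : C.X.Opens))) hφ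

end Cocycle

/-! ### Construction of `𝒪(p)` -/

lemma exists_isClosed_singleton (C : NonsingularCurve) : ∃ p : C.X, IsClosed ({p} : Set C.X) := by
  have : CompactSpace C.X :=
    QuasiCompact.compactSpace_of_compactSpace C.str
  obtain ⟨p, -, hp⟩ := isClosed_univ.exists_closed_singleton (S := (Set.univ : Set C.X))
    Set.univ_nonempty
  exact ⟨p, hp⟩

lemma ord_eq_one {p : C.X} (hp : IsClosed ({p} : Set C.X)) {U : C.X.Opens} [Nonempty U]
    (hU : p ∈ U) {a : Γ(C.X, U)} (ha : Irreducible (C.X.presheaf.germ U p hU a)) :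
    C.X.ord (C.X.germToFunctionField U a) p = 1 := by
  have := C.nonsingular p hp
  -- The order is read off from the valuation of the stalk only at points of codimension one.
  have hcoh : Order.coheight p = 1 := by
    have := ringKrullDim_stalk_eq_coheight p
    rw [IsDiscreteValuationRing.ringKrullDim_eq_one] at this
    exact_mod_cast this.symm
  have : Ring.KrullDimLE 1 (C.X.presheaf.stalk p) := krullDimLE_of_coheight_le hcoh.le
  have hord : C.X.ordHom p hcoh (C.X.germToFunctionField U a) = WithZero.exp 1 := by
    rw [← Scheme.algebraMap_germ_eq_germToFunctionField C.X hU]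
    exact Ring.ordFrac_irreducible ha
  have hne : C.X.germToFunctionField U a ≠ 0 := by
    rintro h
    rw [h, map_zero] at hord
    exact WithZero.exp_ne_zero hord.symm
  rw [Scheme.ord_eq_iff hcoh hne, hord]
  rfl

lemma germ_fres {U V : C.X.Opens} (h : V ≤ U) {x : C.X} (hx : x ∈ V) (a : Γ(C.X, U)) :
    C.X.presheaf.germ V x hx (C.fres h a) = C.X.presheaf.germ U x (h hx) a :=
  C.X.presheaf.germ_res_apply (homOfLE h) x hx a

/-- Each divisibility of germs holds on some neighbourhood of `p`, and finitely many neighbourhoods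
can be intersected. It is applied to generators of the ideal of `p` in an affine chart. -/
lemma exists_fres_dvd {p : C.X} {V : C.X.Opens} (hpV : p ∈ V) {a : Γ(C.X, V)} (S : Finset Γ(C.X, V))
    (hS : ∀ b ∈ S, C.X.presheaf.germ V p hpV a ∣ C.X.presheaf.germ V p hpV b) :
    ∃ (O : C.X.Opens) (h : O ≤ V), p ∈ O ∧ ∀ b ∈ S, C.fres h a ∣ C.fres h b := by
  classical
  induction S using Finset.induction_on with
  | empty => exact ⟨V, le_rfl, hpV, by simp⟩
  | insert b S _ ih =>
    obtain ⟨O, hO, hpO, hdvd⟩ := ih fun b hb ↦ hS b (Finset.mem_insert_of_mem hb)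
    obtain ⟨c, hc⟩ := hS b (Finset.mem_insert_self b S)
    obtain ⟨O₁, hpO₁, (c : Γ(C.X, O₁)), rfl⟩ := C.X.presheaf.exists_germ_eq c
    have hp' : p ∈ V ⊓ O₁ := ⟨hpV, hpO₁⟩
    have heq : C.X.presheaf.germ (V ⊓ O₁) p hp' (C.fres inf_le_left b) =
        C.X.presheaf.germ (V ⊓ O₁) p hp' (C.fres inf_le_left a * C.fres inf_le_right c) := by
      rw [map_mul, germ_fres, germ_fres, germ_fres, hc]
    obtain ⟨O₂, hpO₂, i, j, hij⟩ := C.X.presheaf.germ_eq p _ _ _ _ heq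
    have hb : C.fres i.le (C.fres inf_le_left b) =
      C.fres i.le (C.fres inf_le_left a * C.fres inf_le_right c) := hij
    refine ⟨O ⊓ O₂, inf_le_left.trans hO, ⟨hpO, hpO₂⟩, fun b' hb' ↦ ?_⟩
    rcases Finset.mem_insert.mp hb' with rfl | hb'
    · have := congrArg (C.fres (inf_le_right : O ⊓ O₂ ≤ O₂)) hb
      simp only [map_mul, fres_fres] at this
      exact ⟨_, this⟩
    · simpa using map_dvd (C.fres (inf_le_left : O ⊓ O₂ ≤ O)) (hdvd b' hb')

/-- Near a closed point `p` there is a regular function that vanishes at `p` only, to order one. -/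
lemma exists_uniformizer {p : C.X} (hp : IsClosed ({p} : Set C.X)) :
    ∃ (U : C.X.Opens) (hpU : p ∈ U) (a : Γ(C.X, U)), Irreducible (C.X.presheaf.germ U p hpU a) ∧
      ∀ (x : C.X) (hx : x ∈ U), x ≠ p → IsUnit (C.X.presheaf.germ U x hx a) := by
  have := C.nonsingular p hp
  obtain ⟨ϖ, hϖ⟩ := IsDiscreteValuationRing.exists_irreducible (C.X.presheaf.stalk p)
  obtain ⟨V₀, hpV₀, a₀, rfl⟩ := C.X.presheaf.exists_germ_eq ϖ
  obtain ⟨V, hV, hpV, hVV₀⟩ := exists_isAffineOpen_mem_and_subset hpV₀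
  have hle : V ≤ V₀ := hVV₀
  let a : Γ(C.X, V) := C.fres hle a₀
  have ha : Irreducible (C.X.presheaf.germ V p hpV a) := by rwa [germ_fres]
  have : IsNoetherianRing Γ(C.X, V) := IsLocallyNoetherian.component_noetherian ⟨V, hV⟩
  -- `I` is the ideal of `p` in the affine chart. In the stalk at `p` the uniformizer divides each
  -- of its finitely many generators, hence also on a smaller `U`.
  let I := (IsLocalRing.maximalIdeal (C.X.presheaf.stalk p)).comap (C.X.presheaf.germ V p hpV).hom
  obtain ⟨S, hS⟩ : I.FG := IsNoetherian.noetherian I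
  obtain ⟨U, hUV, hpU, hdvd⟩ := exists_fres_dvd hpV (a := a) S fun b hb ↦ by
    have hbI : b ∈ I := hS ▸ Ideal.subset_span hb
    rwa [Ideal.mem_comap, ha.maximalIdeal_eq, Ideal.mem_span_singleton] at hbI
  refine ⟨U, hpU, C.fres hUV a, by rwa [germ_fres], fun x hx hxp ↦ ?_⟩
  by_contra hnu
  let J := (IsLocalRing.maximalIdeal (C.X.presheaf.stalk x)).comap
    (C.X.presheaf.germ V x (hUV hx)).hom
  -- If `a` were not a unit at `x`, then neither would be its multiples, so all of `I` would vanish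
  -- at `x`.
  have hIJ : I ≤ J := by
    rw [← hS]
    refine Ideal.span_le.mpr fun b hb ↦ ?_
    have hb' := map_dvd (C.X.presheaf.germ U x hx).hom (hdvd b hb)
    change C.X.presheaf.germ U x hx _ ∣ C.X.presheaf.germ U x hx _ at hb'
    rw [germ_fres hUV hx b] at hb'
    exact (IsLocalRing.mem_maximalIdeal _).mpr fun hu ↦ hnu (isUnit_of_dvd_unit hb' hu)
  -- Since `{p}` is closed and `V` affine, some `f` vanishes at `p` but not at `x`, a contradiction.
  obtain ⟨f, hf, hxf⟩ := hV.exists_basicOpen_le (V := ⟨{p}ᶜ, hp.isOpen_compl⟩) ⟨x, hxp⟩ (hUV hx)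
  have hfI : f ∈ I := (IsLocalRing.mem_maximalIdeal _).mpr fun hu ↦
    hf ((C.X.mem_basicOpen f p hpV).mpr hu) rfl
  exact (IsLocalRing.mem_maximalIdeal _).mp (hIJ hfI) ((C.X.mem_basicOpen f x (hUV hx)).mp hxf)

/-- There is a line bundle of degree one with a nonzero section, namely `𝒪(p)`. -/
lemma exists_cocycle (C : NonsingularCurve) : ∃ (p : C.X) (L : C.Cocycle) (a : Γ(C.X, L.U)),
    L.HasDivisor p 1 ∧ C.fres inf_le_right a = L.g.1 := by
  obtain ⟨p, hp⟩ := C.exists_isClosed_singleton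
  obtain ⟨U, hpU, a, ha, hunit⟩ := exists_uniformizer hp
  let W : C.X.Opens := ⟨{p}ᶜ, hp.isOpen_compl⟩
  have hu : IsUnit (C.fres (inf_le_right : W ⊓ U ≤ U) a) := by
    refine C.X.toRingedSpace.isUnit_of_isUnit_germ _ _ fun x hx ↦ ?_
    have := hunit x hx.2 hx.1
    rwa [← germ_fres (inf_le_right : W ⊓ U ≤ U) hx] at this
  have hU : Nonempty U := ⟨⟨p, hpU⟩⟩
  have hord := ord_eq_one hp hpU ha
  have hcover (V : C.X.Opens) : V ≤ V ⊓ W ⊔ V ⊓ U := fun x hx ↦ by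
    by_cases hxp : x = p
    · exact Or.inr ⟨hx, hxp ▸ hpU⟩
    · exact Or.inl ⟨hx, hxp⟩
  refine ⟨p, ⟨W, U, hcover, hu.unit⟩, a, ⟨fun _ ↦ Iff.rfl, hpU, ?_, fun h ↦ ?_⟩, rfl⟩
  -- If `W` were empty, `p` would be the generic point, whose stalk is a field, whereas a discrete
  -- valuation ring is not.
  · by_contra hW
    have hgen : genericPoint C.X = p := by
      by_contra h
      exact hW ⟨⟨_, h⟩⟩
    have := C.nonsingular p hp
    have hfield := IsDiscreteValuationRing.not_isField (C.X.presheaf.stalk p)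
    rw [← hgen] at hfield
    exact hfield (Field.toIsField C.X.functionField)
  · change Nonempty (W ⊓ U : C.X.Opens) at h
    rw [← hord, ← germToFunctionField_fres (inf_le_right : W ⊓ U ≤ U)]
    rfl

/-! ### Iterating the twist -/

lemma exists_isStable_twist {n : ℕ} {d : ℤ} {k : ℕ} {E : C.X.Modules} (hE : C.IsStable n d E)
    (hk : (k : Cardinal) ≤ C.h0 E) (d' : ℕ) :
    ∃ F, C.IsStable n (d + n * d') F ∧ (k : Cardinal) ≤ C.h0 F := by
  induction d' with
  | zero => exact ⟨E, by simpa using hE, hk⟩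
  | succ d' ih =>
    obtain ⟨F, hF, hkF⟩ := ih
    obtain ⟨p, L, a, hL, ha⟩ := C.exists_cocycle
    have := hL.nonempty_W
    refine ⟨L.twist F, ?_, hkF.trans (Cocycle.h0_le_h0_twist a ha hF.isVectorBundle)⟩
    convert! hL.isStable_twist hF using 1
    push_cast
    ring

lemma exists_isSemistable_twist {n : ℕ} {d : ℤ} {k : ℕ} {E : C.X.Modules}
    (hE : C.IsSemistable n d E) (hk : (k : Cardinal) ≤ C.h0 E) (d' : ℕ) :
    ∃ F, C.IsSemistable n (d + n * d') F ∧ (k : Cardinal) ≤ C.h0 F := by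
  induction d' with
  | zero => exact ⟨E, by simpa using hE, hk⟩
  | succ d' ih =>
    obtain ⟨F, hF, hkF⟩ := ih
    obtain ⟨p, L, a, hL, ha⟩ := C.exists_cocycle
    have := hL.nonempty_W
    refine ⟨L.twist F, ?_, hkF.trans (Cocycle.h0_le_h0_twist a ha hF.isVectorBundle)⟩
    convert! hL.isSemistable_twist hF using 1
    push_cast
    ring

end NonsingularCurve

end

theorem theorem3p1 (C : NonsingularCurve) (n : ℕ) (d : ℤ) (k : ℕ) :
    ((C.brillNoether n d k).Nonempty →
      ∀ d' : ℕ, (C.brillNoether n (d + n * d') k).Nonempty) ∧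
    ((C.brillNoetherSemistable n d k).Nonempty →
      ∀ d' : ℕ, (C.brillNoetherSemistable n (d + n * d') k).Nonempty) := by
  constructor
  · rintro ⟨_, ⟨E, hE⟩, -, hk⟩ d'
    obtain ⟨F, hF, hkF⟩ := NonsingularCurve.exists_isStable_twist hE hk d'
    exact ⟨_, ⟨F, hF⟩, rfl, hkF⟩
  · rintro ⟨_, ⟨E, hE⟩, -, hk⟩ d'
    obtain ⟨F, hF, hkF⟩ := NonsingularCurve.exists_isSemistable_twist hE hk d'
    exact ⟨_, ⟨F, hF⟩, rfl, hkF⟩
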